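/- Notation. Let $B_1=\chi_{[-1/2,1/2]}$ and $B_{n+1}=B_n*B_1$ for $n\ge 1$. For $a,b>0$ and $g\in L^2(\mathbb R)$ let $\mathcal G(g,a,b)=\{e^{2\pi i b m x}g(x-ak)\}_{k,m\in\mathbb Z}$. A family $\{f_i\}$ in $L^2(\mathbb R)$ is a frame if there are constants $0<A\le B<\infty$ with $A\|f\|^2\le\sum_i|\langle f,f_i\rangle|^2\le B\|f\|^2$ for all $f\in L^2(\mathbb R)$. Let $\mathcal F(B_n)$ be the set of all $(a,b)\in(0,\infty)^2$ such that $\mathcal G(B_n,a,b)$ is a frame for $L^2(\mathbb R)$, and let $R(b)=\lfloor b+\tfrac12\rfloor$ be the integer nearest to $b$. Theorem. (1) Let $n\ge 1$ be an integer, let $a>0$ and $b>\frac32$, and let $p,q\ge 1$ be coprime integers. If $ab=\frac pq$ and $|b-R(b)|\le\frac1{nq}$, where for $n=1$ the inequality is required to be strict, then $\mathcal G(B_n,a,b)$ is not a frame for $L^2(\mathbb R)$. (2) Let $n\ge1$ and let $1\le p<q$ be coprime integers. For an integer $m\ge 2$ let $P_m$ be the set of all $(a,b)\in(0,\infty)^2$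 with $ab=\frac pq$ and $|b-m|\le\frac1{nq}$ (with strict inequality if $n=1$). Then the sets $P_2,P_3,\dots$ are pairwise disjoint connected pieces of the hyperbola $ab=\frac pq$, each of which has more than one point and is disjoint from $\mathcal F(B_n)$. (3) For every integer $n\ge 2$, $$\mathcal F(B_n)\ne\{(a,b)\in(0,\infty)^2 : ab<1,\ a<n,\ b\ne 2,3,\dots\},$$ so Gröchenig's conjecture on the frame set of B-splines is false for every order $n \ge 2$. -/

import Mathlib

open MeasureTheory

noncomputable section

/-- The B-spline of order `n`: the first one is the characteristic function of
`[-1/2, 1/2]`, and the next one is the convolution with the first one.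
(The value at `n = 0` is a placeholder.) -/
def bspline : ℕ → ℝ → ℝ
  | 0 => fun _ => 0
  | 1 => Set.indicator (Set.Icc (-1 / 2 : ℝ) (1 / 2)) (fun _ => 1)
  | (n + 2) => convolution (bspline (n + 1))
      (Set.indicator (Set.Icc (-1 / 2 : ℝ) (1 / 2)) (fun _ => 1))
      (ContinuousLinearMap.mul ℝ ℝ) volume

theorem integrable_box :
    Integrable (Set.indicator (Set.Icc (-1 / 2 : ℝ) (1 / 2)) (fun _ => (1 : ℝ))) volume := by
  rw [integrable_indicator_iff measurableSet_Icc]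
  exact integrableOn_const (by simp)

theorem abs_box_le (x : ℝ) :
    ‖Set.indicator (Set.Icc (-1 / 2 : ℝ) (1 / 2)) (fun _ => (1 : ℝ)) x‖ ≤ 1 := by
  refine (norm_indicator_le_norm_self _ x).trans ?_
  simp

theorem bspline_integrable_bounded (n : ℕ) :
    Integrable (bspline n) volume ∧ ∃ C : ℝ, ∀ x, ‖bspline n x‖ ≤ C := by
  induction n with
  | zero => exact ⟨integrable_zero _ _ _, 0, fun x => by simp [bspline]⟩
  | succ n ih =>
    cases n with
    | zero => exact ⟨integrable_box, 1, abs_box_le⟩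
    | succ n =>
      obtain ⟨hi, -⟩ := ih
      refine ⟨hi.integrable_convolution (ContinuousLinearMap.mul ℝ ℝ) integrable_box,
        ∫ t, ‖bspline (n + 1) t‖, fun x => ?_⟩
      refine norm_integral_le_of_norm_le hi.norm (Filter.Eventually.of_forall fun t => ?_)
      simp only [ContinuousLinearMap.mul_apply', norm_mul]
      exact mul_le_of_le_one_right (norm_nonneg _) (abs_box_le _)

/-- The B-splines are square-integrable; as usual they are regarded as complex-valued. -/
theorem bspline_memLp (n : ℕ) : MemLp (fun x => (bspline n x : ℂ)) 2 (volume : Measure ℝ) := by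
  obtain ⟨hi, C, hC⟩ := bspline_integrable_bounded n
  refine MemLp.ofReal ((memLp_two_iff_integrable_sq hi.aestronglyMeasurable).2 ?_)
  have := hi.bdd_mul hi.aestronglyMeasurable (Filter.Eventually.of_forall hC)
  simpa [sq] using this

/-- The time-frequency shift `x ↦ exp(2 π i b m x) g(x - a k)`. -/
def timeFrequencyShift (g : ℝ → ℂ) (a b : ℝ) (k m : ℤ) : ℝ → ℂ :=
  fun x => Complex.exp (2 * Real.pi * Complex.I * b * m * x) * g (x - a * k)

theorem timeFrequencyShift_memLp {g : ℝ → ℂ} (hg : MemLp g 2 (volume : Measure ℝ))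
    (a b : ℝ) (k m : ℤ) : MemLp (timeFrequencyShift g a b k m) 2 (volume : Measure ℝ) := by
  have h1 : MemLp (fun x => g (x - a * k)) 2 (volume : Measure ℝ) :=
    hg.comp_measurePreserving (measurePreserving_sub_right volume (a * k))
  refine h1.of_le (AEStronglyMeasurable.mul ?_ h1.aestronglyMeasurable)
    (Filter.Eventually.of_forall fun x => ?_)
  · exact Continuous.aestronglyMeasurable (by fun_prop)
  · have : (2 * Real.pi * Complex.I * b * m * x : ℂ)
        = ((2 * Real.pi * b * m * x : ℝ) : ℂ) * Complex.I := by push_cast; ring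
    simp only [timeFrequencyShift, norm_mul]
    rw [this, Complex.norm_exp_ofReal_mul_I, one_mul]

/-- The Gabor system generated by the square-integrable function `g`, as a family in `L²(ℝ)`
indexed by `(k, m) ∈ ℤ × ℤ`. -/
def gaborSystem (g : ℝ → ℂ) (hg : MemLp g 2 (volume : Measure ℝ)) (a b : ℝ) :
    ℤ × ℤ → Lp ℂ 2 (volume : Measure ℝ) :=
  fun i => (timeFrequencyShift_memLp hg a b i.1 i.2).toLp _

/-- A family of vectors in an inner product space is a frame if it has a lower frame bound
`A > 0` and a finite upper frame bound `B`. -/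
def IsFrame {ι H : Type*} [NormedAddCommGroup H] [InnerProductSpace ℂ H] (f : ι → H) : Prop :=
  ∃ A B : ℝ, 0 < A ∧ 0 < B ∧ ∀ x : H,
    Summable (fun i => ‖inner ℂ (f i) x‖ ^ 2) ∧
    A * ‖x‖ ^ 2 ≤ ∑' i, ‖inner ℂ (f i) x‖ ^ 2 ∧
    ∑' i, ‖inner ℂ (f i) x‖ ^ 2 ≤ B * ‖x‖ ^ 2

/-- The Gabor system `𝒢(Bₙ, a, b)` in `L²(ℝ)`. -/
def bsplineGabor (n : ℕ) (a b : ℝ) : ℤ × ℤ → Lp ℂ 2 (volume : Measure ℝ) :=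
  gaborSystem (fun x => (bspline n x : ℂ)) (bspline_memLp n) a b

/-- The frame set of the B-spline of order `n`. -/
def bsplineFrameSet (n : ℕ) : Set (ℝ × ℝ) :=
  {ab | 0 < ab.1 ∧ 0 < ab.2 ∧ IsFrame (bsplineGabor n ab.1 ab.2)}

/-- The piece of the hyperbola `a b = p / q` that is located around `b = m`:
`|b - m| ≤ 1 / (n q)`, with the end points left out if `n = 1`. -/
def hyperbolaPiece (n p q : ℕ) (m : ℤ) : Set (ℝ × ℝ) :=
  {ab | 0 < ab.1 ∧ 0 < ab.2 ∧ ab.1 * ab.2 = (p : ℝ) / q ∧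
    |ab.2 - m| ≤ 1 / ((n : ℝ) * q) ∧ (n = 1 → |ab.2 - m| < 1 / (q : ℝ))}

end

/-! The proof rests on zeros of the Zak transform `zak h ω y = ∑ⱼ ω ^ j h (y + j)` of the dilated
spline `h z = Bₙ (z / b)`, where `ω ≠ 1` is an `m`-th root of unity and `m` is the integer nearest
to `b`.

The dilated spline of order `n + 1` arises from that of order `n` by averaging over intervals of
length `b`, and the Zak transform inherits this recursion (`zak_average`). A unit translation of `y`
multiplies the Zak transform by `ω⁻¹`, so its integral over an interval of length `m` vanishes
(`integral_zak_eq_zero`), and in the recursion only an integral over an interval of length `|b - m|`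
is left. For `n = 1` the Zak transform is a sum of `m` consecutive powers of `ω`, hence zero, unless
`y` lies within `|b - m| / 2` of the coset `m / 2 + ℤ`. By induction the Zak transform of order `n`
vanishes at all points whose distance from `n m / 2 + ℤ` exceeds `n |b - m| / 2`, and for `n ≥ 2`
also at those where equality holds (`zak_dilatedSpline_eq_zero`, `zak_dilatedSpline_step`). If
`n |b - m| ≤ 1 / q`, the whole coset `n m / 2 + 1 / (2 q) + q⁻¹ ℤ` consists of such points.

If `a b = p / q`, the numbers `y₀ - a b k`, `k ∈ ℤ`, lie in a single coset of `q⁻¹ ℤ`. When the Zak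
transform vanishes on that coset and `h` is continuous there, the Gabor system is tested on step
functions with the values `conj (ω ^ j)` on short intervals to the right of `(y₀ + j) / b`,
`0 ≤ j < N`. By Parseval's identity the sum of the squared coefficients is an integral of squared
partial sums of the Zak transform near the coset. These are small except for a number of indices `k`
that does not depend on `N`, whereas the squared norm of the step function is proportional to `N`.
So there is no lower frame bound (`not_isFrame_gaborSystem`). -/

/-! ### The Zak transform -/

/-- The Zak transform of `h` at `y`. The dual variable `θ` enters through the unimodular number
`ω = exp (2 π i θ)`. -/
noncomputable def zak (h : ℝ → ℂ) (ω : ℂ) (y : ℝ) : ℂ := ∑' j : ℤ, ω ^ j * h (y + j)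

section Zak

variable {h : ℝ → ℂ} {ω : ℂ} {ρ : ℝ}

theorem zak_eq_sum (hρ : ∀ z, ρ < |z| → h z = 0) {y : ℝ} {J : Finset ℤ}
    (hJ : ∀ j : ℤ, |y + j| ≤ ρ → j ∈ J) : zak h ω y = ∑ j ∈ J, ω ^ j * h (y + j) := by
  refine tsum_eq_sum fun j hj => ?_
  rw [hρ _ (not_le.1 fun hle => hj (hJ j hle)), mul_zero]

theorem zak_eq_sum_Icc (hρ : ∀ z, ρ < |z| → h z = 0) {c d y : ℝ} (hy : y ∈ Set.Icc c d) :
    zak h ω y = ∑ j ∈ Finset.Icc ⌊-ρ - d⌋ ⌈ρ - c⌉, ω ^ j * h (y + j) := by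
  refine zak_eq_sum hρ fun j hj => Finset.mem_Icc.2 ⟨?_, ?_⟩
  · have := (abs_le.1 hj).1
    exact Int.cast_le.1 ((Int.floor_le (-ρ - d)).trans (by linarith [hy.2] : _ ≤ (j : ℝ)))
  · have := (abs_le.1 hj).2
    exact Int.cast_le.1 ((by linarith [hy.1] : (j : ℝ) ≤ _).trans (Int.le_ceil (ρ - c)))

theorem zak_add_intCast (hω : ω ≠ 0) (y : ℝ) (i : ℤ) :
    zak h ω (y + i) = ω ^ (-i) * zak h ω y := by
  rw [zak, zak, ← tsum_mul_left, ← (Equiv.addRight i).tsum_eq (fun j : ℤ => _ * (ω ^ j * _))]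
  refine tsum_congr fun j => ?_
  rw [Equiv.coe_addRight, ← mul_assoc, ← zpow_add₀ hω, neg_add_cancel_comm_assoc]
  push_cast
  congr 2
  ring

theorem continuousAt_zak (hρ : ∀ z, ρ < |z| → h z = 0) {y : ℝ}
    (hc : ∀ j : ℤ, ContinuousAt h (y + j)) : ContinuousAt (zak h ω) y := by
  have hcont : ContinuousAt (fun z => ∑ j ∈ Finset.Icc ⌊-ρ - (y + 1)⌋ ⌈ρ - (y - 1)⌉,
      ω ^ j * h (z + j)) y := by
    refine tendsto_finsetSum _ fun j _ => ContinuousAt.mul continuousAt_const ?_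
    exact (hc j).comp_of_eq (by fun_prop) rfl
  refine hcont.congr ?_
  filter_upwards [Icc_mem_nhds (sub_one_lt y) (lt_add_one y)] with z hz
  exact (zak_eq_sum_Icc hρ hz).symm

theorem intervalIntegrable_zak (hρ : ∀ z, ρ < |z| → h z = 0) (hi : Integrable h) (c d : ℝ) :
    IntervalIntegrable (zak h ω) volume c d := by
  have hs : IntervalIntegrable (fun y => ∑ j ∈ Finset.Icc ⌊-ρ - max c d⌋ ⌈ρ - min c d⌉,
      ω ^ j * h (y + j)) volume c d :=
    (integrable_finsetSum _ fun (j : ℤ) _ =>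
      (hi.comp_add_right (j : ℝ)).const_mul (ω ^ j)).intervalIntegrable
  refine hs.congr fun y hy => ?_
  exact (zak_eq_sum_Icc hρ (Set.uIoc_subset_uIcc hy)).symm

/-- Over `m` consecutive unit intervals the Zak transform has mean zero if `ω` is a nontrivial
`m`-th root of unity: it is `m`-periodic, and a unit translation multiplies it by `ω⁻¹ ≠ 1`. -/
theorem integral_zak_eq_zero {m : ℕ} (hm : ω ^ m = 1) (h1 : ω ≠ 1) (hm0 : m ≠ 0) (c : ℝ) :
    ∫ u in c..c + m, zak h ω u = 0 := by
  have hω : ω ≠ 0 := by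
    rintro rfl
    simp [hm0] at hm
  have hper : Function.Periodic (zak h ω) m := fun y => by
    have := zak_add_intCast (h := h) hω y m
    simpa [hm] using this
  have e1 : ∫ u in (c + 1)..(c + 1) + m, zak h ω u = ω⁻¹ * ∫ u in c..c + m, zak h ω u := by
    rw [← intervalIntegral.integral_const_mul, show c + 1 + (m : ℝ) = c + m + 1 by ring,
      ← intervalIntegral.integral_comp_add_right (fun u => zak h ω u)]
    refine intervalIntegral.integral_congr fun u _ => ?_
    simpa using zak_add_intCast (h := h) hω u 1
  rw [hper.intervalIntegral_add_eq (c + 1) c] at e1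
  have h2 : (1 - ω⁻¹) * ∫ u in c..c + m, zak h ω u = 0 := by
    rw [sub_mul, one_mul, ← e1, sub_self]
  rcases mul_eq_zero.1 h2 with h3 | h3
  · exact absurd (inv_eq_one.1 (sub_eq_zero.1 h3).symm) h1
  · exact h3

/-- Averaging a function over intervals of length `b` averages its Zak transform. -/
theorem zak_average (hρ : ∀ z, ρ < |z| → h z = 0) (hi : Integrable h) {b : ℝ} {h' : ℝ → ℂ}
    {ρ' : ℝ} (hρ' : ∀ z, ρ' < |z| → h' z = 0)
    (hh' : ∀ y, h' y = (b : ℂ)⁻¹ * ∫ u in (y - b / 2)..(y + b / 2), h u) (y : ℝ) :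
    zak h' ω y = (b : ℂ)⁻¹ * ∫ u in (y - b / 2)..(y + b / 2), zak h ω u := by
  set R := max ρ ρ'
  have e1 : zak h' ω y = ∑ j ∈ Finset.Icc ⌊-R - (y + |b|)⌋ ⌈R - (y - |b|)⌉, ω ^ j * h' (y + j) :=
    zak_eq_sum_Icc (fun z hz => hρ' z ((le_max_right _ _).trans_lt hz))
      ⟨by linarith [abs_nonneg b], by linarith [abs_nonneg b]⟩
  have e2 : ∫ u in (y - b / 2)..(y + b / 2), zak h ω u =
      ∫ u in (y - b / 2)..(y + b / 2), ∑ j ∈ Finset.Icc ⌊-R - (y + |b|)⌋ ⌈R - (y - |b|)⌉,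
        ω ^ j * h (u + j) := by
    refine intervalIntegral.integral_congr fun u hu => ?_
    refine zak_eq_sum_Icc (fun z hz => hρ z ((le_max_left _ _).trans_lt hz)) ?_
    have := le_abs_self b
    have := neg_abs_le b
    rcases Set.mem_uIcc.1 hu with hu | hu <;> constructor <;> linarith [hu.1, hu.2, abs_nonneg b]
  rw [e1, e2, intervalIntegral.integral_finsetSum 
      (f := fun (j : ℤ) (u : ℝ) => ω ^ j * h (u + j)) fun j _ =>
    ((hi.comp_add_right (j : ℝ)).const_mul (ω ^ j)).intervalIntegrable, Finset.mul_sum]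
  refine Finset.sum_congr rfl fun j _ => ?_
  rw [hh', intervalIntegral.integral_const_mul, intervalIntegral.integral_comp_add_right]
  rw [show y - b / 2 + (j : ℝ) = y + j - b / 2 by ring,
    show y + b / 2 + (j : ℝ) = y + j + b / 2 by ring]
  ring

end Zak

/-! ### Zeros of the Zak transform of a B-spline -/

section Spline

theorem bspline_one (x : ℝ) :
    bspline 1 x = Set.indicator (Set.Icc (-1 / 2 : ℝ) (1 / 2)) (fun _ => 1) x := rfl

theorem bspline_add_two (n : ℕ) (x : ℝ) :
    bspline (n + 2) x = ∫ t in (x - 1 / 2)..(x + 1 / 2), bspline (n + 1) t := by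
  rw [intervalIntegral.integral_of_le (by linarith), ← integral_Icc_eq_integral_Ioc,
    ← integral_indicator measurableSet_Icc]
  change ∫ t, _ = _
  refine integral_congr_ae (Filter.Eventually.of_forall fun t => ?_)
  simp only [ContinuousLinearMap.mul_apply', Set.indicator_apply, Set.mem_Icc]
  have : (-1 / 2 ≤ x - t ∧ x - t ≤ 1 / 2) ↔ (x - 1 / 2 ≤ t ∧ t ≤ x + 1 / 2) := by
    constructor <;> rintro ⟨h1, h2⟩ <;> constructor <;> linarith
  simp only [this]
  split_ifs <;> simp

theorem bspline_eq_zero (n : ℕ) {x : ℝ} (hx : (n : ℝ) / 2 < |x|) : bspline n x = 0 := by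
  induction n generalizing x with
  | zero => rfl
  | succ n ih =>
    cases n with
    | zero =>
      refine Set.indicator_of_notMem (fun hm => hx.not_ge ?_) _
      rw [abs_le]
      push_cast
      constructor <;> linarith [hm.1, hm.2]
    | succ n =>
      rw [bspline_add_two]
      refine (intervalIntegral.integral_congr fun t ht => ?_).trans
        intervalIntegral.integral_zero
      rw [Set.uIcc_of_le (by linarith)] at ht
      refine ih (lt_of_lt_of_le (sub_lt_sub_right hx (1 / 2) |>.trans_le' ?_) ?_ : _ < |t|)
      · push_cast; linarith
      · have : |x - t| ≤ 1 / 2 := abs_le.2 ⟨by linarith [ht.1, ht.2], by linarith [ht.1, ht.2]⟩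
        linarith [abs_sub_abs_le_abs_sub x t]

theorem continuous_bspline (n : ℕ) : Continuous (bspline (n + 2)) := by
  have hi : ∀ c d, IntervalIntegrable (bspline (n + 1)) volume c d := fun c d =>
    (bspline_integrable_bounded (n + 1)).1.intervalIntegrable
  have hp := intervalIntegral.continuous_primitive hi 0
  have : bspline (n + 2) = fun x => (∫ t in (0 : ℝ)..(x + 1 / 2), bspline (n + 1) t) -
      ∫ t in (0 : ℝ)..(x - 1 / 2), bspline (n + 1) t := by
    ext x
    rw [bspline_add_two, intervalIntegral.integral_interval_sub_left (hi _ _) (hi _ _)]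
  rw [this]
  exact (hp.comp (by fun_prop)).sub (hp.comp (by fun_prop))

theorem continuousAt_bspline_one {x : ℝ} (hx : |x| ≠ 1 / 2) : ContinuousAt (bspline 1) x := by
  rcases lt_or_gt_of_ne hx with h | h
  · have : bspline 1 =ᶠ[nhds x] fun _ => 1 := by
      filter_upwards [(isOpen_lt continuous_abs continuous_const).mem_nhds h] with z hz
      have := abs_lt.1 (hz : |z| < 1 / 2)
      exact Set.indicator_of_mem (Set.mem_Icc.2 ⟨by linarith, by linarith⟩) _
    exact continuousAt_const.congr this.symm
  · have : bspline 1 =ᶠ[nhds x] fun _ => 0 := by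
      filter_upwards [(isOpen_lt continuous_const continuous_abs).mem_nhds h] with z hz
      exact bspline_eq_zero 1 (by simpa using hz)
    exact continuousAt_const.congr this.symm

/-- The B-spline of order `n`, dilated by `b` and regarded as complex-valued. -/
noncomputable def dilatedSpline (n : ℕ) (b : ℝ) (z : ℝ) : ℂ := (bspline n (z / b) : ℂ)

variable {b : ℝ} {m : ℕ} {ω : ℂ}

theorem dilatedSpline_eq_zero (n : ℕ) (hb : 0 < b) (z : ℝ) (hz : n * b / 2 < |z|) :
    dilatedSpline n b z = 0 := by
  rw [dilatedSpline, bspline_eq_zero, Complex.ofReal_zero]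
  rw [abs_div, abs_of_pos hb, lt_div_iff₀ hb]
  linarith

theorem integrable_dilatedSpline (n : ℕ) (hb : b ≠ 0) : Integrable (dilatedSpline n b) :=
  ((bspline_integrable_bounded n).1.comp_div hb).ofReal

theorem dilatedSpline_add_two (n : ℕ) (hb : 0 < b) (y : ℝ) : dilatedSpline (n + 2) b y =
    (b : ℂ)⁻¹ * ∫ u in (y - b / 2)..(y + b / 2), dilatedSpline (n + 1) b u := by
  have e : ∫ u in (y - b / 2)..(y + b / 2), bspline (n + 1) (u / b) =
      b * ∫ u in (y / b - 1 / 2)..(y / b + 1 / 2), bspline (n + 1) u := by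
    rw [intervalIntegral.integral_comp_div _ hb.ne', smul_eq_mul, sub_div, add_div,
      div_right_comm, div_self hb.ne']
  simp only [dilatedSpline]
  rw [intervalIntegral.integral_ofReal, e, bspline_add_two]
  push_cast
  rw [inv_mul_cancel_left₀ (by exact_mod_cast hb.ne')]

theorem sum_Ico_zpow_eq_zero (hm : ω ^ m = 1) (h1 : ω ≠ 1) (hm0 : m ≠ 0) (c : ℤ) :
    ∑ j ∈ Finset.Ico c (c + m), ω ^ j = 0 := by
  have hω : ω ≠ 0 := by
    rintro rfl
    simp [hm0] at hm
  have e : Finset.Ico c (c + m) = (Finset.range m).image (fun l : ℕ => c + (l : ℤ)) := by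
    ext j
    simp only [Finset.mem_Ico, Finset.mem_image, Finset.mem_range]
    constructor
    · rintro ⟨h2, h3⟩
      exact ⟨(j - c).toNat, by omega, by omega⟩
    · rintro ⟨l, hl, rfl⟩
      omega
  rw [e, Finset.sum_image fun x _ y _ hxy => by simpa using hxy]
  simp only [zpow_add₀ hω, zpow_natCast]
  rw [← Finset.mul_sum, geom_sum_eq h1, hm, sub_self, zero_div, mul_zero]

/-- Away from the jumps, exactly `m` consecutive integer translates of `y` lie in the support of
the dilated box, if the length `b` of that support is close to `m`. -/
theorem zak_box_eq_zero (hb : 0 < b) (hm : ω ^ m = 1) (h1 : ω ≠ 1) (hm0 : m ≠ 0) {y : ℝ}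
    (hy : ∀ i : ℤ, |b - m| / 2 < |y - m / 2 - i|) : zak (dilatedSpline 1 b) ω y = 0 := by
  have key : ∀ j : ℤ, dilatedSpline 1 b (y + j) =
      if j ∈ Finset.Ico ⌈-(m / 2 : ℝ) - y⌉ (⌈-(m / 2 : ℝ) - y⌉ + m) then 1 else 0 := by
    intro j
    have hl := hy (-j - m)
    have hr := hy (-j)
    push_cast at hl hr
    have hd := abs_le.1 (le_refl |b - m|)
    have hiff : (y + j) / b ∈ Set.Icc (-1 / 2 : ℝ) (1 / 2) ↔
        j ∈ Finset.Ico ⌈-(m / 2 : ℝ) - y⌉ (⌈-(m / 2 : ℝ) - y⌉ + m) := by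
      rw [Finset.mem_Ico, Int.ceil_le, ← sub_lt_iff_lt_add, Int.lt_ceil, Set.mem_Icc,
        le_div_iff₀ hb, div_le_iff₀ hb]
      push_cast
      rcases lt_abs.1 hl with hl | hl <;> rcases lt_abs.1 hr with hr | hr <;>
        constructor <;> rintro ⟨h2, h3⟩ <;> constructor <;> linarith
    rw [dilatedSpline, bspline_one, Set.indicator_apply]
    simp only [hiff]
    split_ifs <;> simp
  rw [zak, tsum_eq_sum (s := Finset.Ico ⌈-(m / 2 : ℝ) - y⌉ (⌈-(m / 2 : ℝ) - y⌉ + m))]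
  · rw [← sum_Ico_zpow_eq_zero hm h1 hm0 ⌈-(m / 2 : ℝ) - y⌉]
    refine Finset.sum_congr rfl fun j hj => ?_
    rw [key, if_pos hj, mul_one]
  · intro j hj
    rw [key, if_neg hj, mul_zero]

theorem zak_dilatedSpline_add_two (n : ℕ) (hb : 0 < b) (hm : ω ^ m = 1) (h1 : ω ≠ 1)
    (hm0 : m ≠ 0) (y : ℝ) : zak (dilatedSpline (n + 2) b) ω y =
      (b : ℂ)⁻¹ * ∫ u in (y - b / 2)..(y + b / 2 - m), zak (dilatedSpline (n + 1) b) ω u := by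
  rw [zak_average (dilatedSpline_eq_zero (n + 1) hb) (integrable_dilatedSpline _ hb.ne')
    (dilatedSpline_eq_zero (n + 2) hb) (b := b)]
  · have hi := intervalIntegrable_zak (ω := ω) (dilatedSpline_eq_zero (n + 1) hb)
      (integrable_dilatedSpline _ hb.ne')
    have h0 := integral_zak_eq_zero (h := dilatedSpline (n + 1) b) hm h1 hm0 (y + b / 2 - m)
    rw [sub_add_cancel] at h0
    rw [← intervalIntegral.integral_add_adjacent_intervals (hi _ (y + b / 2 - m)) (hi _ _), h0,
      add_zero]
  · intro y
    rw [dilatedSpline_add_two n hb]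

/-- If the Zak transform of a spline vanishes at distance more than `n |b - m| / 2` from a coset of
`ℤ`, so does that of the next one, with `n + 1` for `n` and the end points included. -/
theorem zak_dilatedSpline_step (n : ℕ) (hb : 0 < b) (hm : ω ^ m = 1) (h1 : ω ≠ 1) (hm0 : m ≠ 0)
    (ih : ∀ y : ℝ, (∀ i : ℤ, (n + 1) * |b - m| / 2 < |y - (n + 1) * m / 2 - i|) →
      zak (dilatedSpline (n + 1) b) ω y = 0) {y : ℝ}
    (hy : ∀ i : ℤ, (n + 2) * |b - m| / 2 ≤ |y - (n + 2) * m / 2 - i|) :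
    zak (dilatedSpline (n + 2) b) ω y = 0 := by
  rw [zak_dilatedSpline_add_two n hb hm h1 hm0, mul_eq_zero]
  refine Or.inr ?_
  have hzero : ∀ u : ℝ, |u - (y - m / 2)| < |b - m| / 2 →
      zak (dilatedSpline (n + 1) b) ω u = 0 := by
    refine fun u hu => ih u fun i => ?_
    have h2 := hy i
    have h3 := abs_sub_abs_le_abs_sub (y - (n + 2) * m / 2 - i) (u - (n + 1) * m / 2 - i)
    have h4 : |y - (n + 2) * m / 2 - i - (u - (n + 1) * m / 2 - i)| = |u - (y - m / 2)| := by
      rw [abs_sub_comm]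
      congr 1
      ring
    linarith
  rcases le_total (m : ℝ) b with hle | hle
  · rw [intervalIntegral.integral_of_le (by linarith), integral_Ioc_eq_integral_Ioo]
    refine setIntegral_eq_zero_of_forall_eq_zero fun u hu => hzero u ?_
    rw [abs_of_nonneg (sub_nonneg.2 hle), abs_lt]
    constructor <;> linarith [hu.1, hu.2]
  · rw [intervalIntegral.integral_of_ge (by linarith), integral_Ioc_eq_integral_Ioo, neg_eq_zero]
    refine setIntegral_eq_zero_of_forall_eq_zero fun u hu => hzero u ?_
    rw [abs_of_nonpos (sub_nonpos.2 hle), abs_lt]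
    constructor <;> linarith [hu.1, hu.2]

theorem zak_dilatedSpline_eq_zero (n : ℕ) (hb : 0 < b) (hm : ω ^ m = 1) (h1 : ω ≠ 1) (hm0 : m ≠ 0)
    {y : ℝ} (hy : ∀ i : ℤ, (n + 1) * |b - m| / 2 < |y - (n + 1) * m / 2 - i|) :
    zak (dilatedSpline (n + 1) b) ω y = 0 := by
  induction n generalizing y with
  | zero => exact zak_box_eq_zero hb hm h1 hm0 fun i => by simpa using hy i
  | succ n ih =>
    refine zak_dilatedSpline_step n hb hm h1 hm0 (fun y hy => ih hy) fun i => ?_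
    have := (hy i).le
    push_cast at this
    rwa [add_assoc, one_add_one_eq_two] at this

end Spline

/-! ### Partial sums of the Zak transform -/

section Section

variable {h : ℝ → ℂ} {ω : ℂ} {ρ : ℝ}

/-- By quasi-periodicity, zeros of the Zak transform on a coset of `q⁻¹ ℤ` at points of continuity
give uniform smallness near that coset. -/
theorem exists_norm_zak_lt (hω : ‖ω‖ = 1) (hρ : ∀ z, ρ < |z| → h z = 0) {q : ℕ} (hq : q ≠ 0)
    {y₀ : ℝ} (hc : ∀ i : ℤ, ContinuousAt h (y₀ + i / q))
    (hz : ∀ i : ℤ, zak h ω (y₀ + i / q) = 0) {η : ℝ} (hη : 0 < η) :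
    ∃ δ > 0, ∀ t : ℝ, |t| < δ → ∀ i : ℤ, ‖zak h ω (y₀ + i / q + t)‖ < η := by
  have hω0 : ω ≠ 0 := norm_ne_zero_iff.1 (by rw [hω]; exact one_ne_zero)
  have hq' : (q : ℝ) ≠ 0 := Nat.cast_ne_zero.2 hq
  have hev : ∀ᶠ t in nhds (0 : ℝ), ∀ r ∈ Finset.range q,
      ‖zak h ω (y₀ + ((r : ℤ) : ℝ) / q + t)‖ < η := by
    refine (Filter.eventually_all_finset _).2 fun r _ => ?_
    have hcr : ContinuousAt (zak h ω) (y₀ + ((r : ℤ) : ℝ) / q) := by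
      refine continuousAt_zak hρ fun j => ?_
      have := hc (r + q * j)
      push_cast at this ⊢
      rwa [add_div, mul_div_cancel_left₀ _ hq', ← add_assoc] at this
    have hct : ContinuousAt (fun t => ‖zak h ω (y₀ + ((r : ℤ) : ℝ) / q + t)‖) 0 :=
      (hcr.comp_of_eq (by fun_prop) (by simp)).norm
    refine hct.eventually_lt continuousAt_const ?_
    rw [add_zero, hz, norm_zero]
    exact hη
  obtain ⟨δ, hδ, H⟩ := Metric.eventually_nhds_iff.1 hev
  refine ⟨δ, hδ, fun t ht i => ?_⟩
  have hr := H (show dist t 0 < δ by simpa using ht) (i % q).toNat (by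
    have := Int.emod_lt_of_pos i (show (0 : ℤ) < q by omega)
    have := Int.emod_nonneg i (show (q : ℤ) ≠ 0 by omega)
    rw [Finset.mem_range]
    omega)
  rw [Int.toNat_of_nonneg (Int.emod_nonneg i (by omega))] at hr
  have e : y₀ + (i : ℝ) / q + t = y₀ + ((i % q : ℤ) : ℝ) / q + t + ((i / q : ℤ) : ℝ) := by
    have : (i : ℝ) = q * ((i / q : ℤ) : ℝ) + ((i % q : ℤ) : ℝ) := by
      exact_mod_cast (Int.mul_ediv_add_emod i q).symm
    rw [this, add_div, mul_div_cancel_left₀ _ hq']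
    ring
  rwa [e, zak_add_intCast hω0, norm_mul, norm_zpow, hω, one_zpow, one_mul]

/-- The partial sum of the Zak transform over `0 ≤ j < N`. -/
noncomputable def zakSection (h : ℝ → ℂ) (ω : ℂ) (N : ℕ) (y : ℝ) : ℂ :=
  ∑ j ∈ Finset.Ico (0 : ℤ) N, ω ^ j * h (y + j)

theorem zakSection_eq_zero (hρ : ∀ z, ρ < |z| → h z = 0) {N : ℕ} {y : ℝ}
    (hy : ρ < y ∨ y < -N - ρ) : zakSection h ω N y = 0 := by
  refine Finset.sum_eq_zero fun j hj => ?_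
  rw [hρ, mul_zero]
  obtain ⟨h1, h2⟩ := Finset.mem_Ico.1 hj
  have h1' : (0 : ℝ) ≤ j := by exact_mod_cast h1
  have h2' : (j : ℝ) < N := by exact_mod_cast h2
  rcases hy with hy | hy
  · exact lt_abs.2 (Or.inl (by linarith))
  · exact lt_abs.2 (Or.inr (by linarith))

theorem zakSection_eq_zak (hρ : ∀ z, ρ < |z| → h z = 0) {N : ℕ} {y : ℝ}
    (h1 : y ≤ -ρ) (h2 : ρ - N < y) : zakSection h ω N y = zak h ω y := by
  refine (zak_eq_sum hρ fun j hj => Finset.mem_Ico.2 ⟨?_, ?_⟩).symm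
  · have := (abs_le.1 hj).1
    exact_mod_cast (by linarith : (0 : ℝ) ≤ j)
  · have := (abs_le.1 hj).2
    exact_mod_cast (by linarith : (j : ℝ) < N)

theorem norm_zakSection_le (hω : ‖ω‖ = 1) (hρ : ∀ z, ρ < |z| → h z = 0) (hρ0 : 0 ≤ ρ) {C : ℝ}
    (hC : ∀ z, ‖h z‖ ≤ C) (N : ℕ) (y : ℝ) : ‖zakSection h ω N y‖ ≤ (2 * ρ + 1) * C := by
  have hC0 : 0 ≤ C := (norm_nonneg _).trans (hC 0)
  have hsub : zakSection h ω N y =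
      ∑ j ∈ (Finset.Ico (0 : ℤ) N).filter (fun j : ℤ => |y + j| ≤ ρ), ω ^ j * h (y + j) := by
    refine (Finset.sum_filter_of_ne fun j _ hj => ?_).symm
    contrapose! hj
    rw [hρ _ hj, mul_zero]
  rw [hsub]
  refine (norm_sum_le _ _).trans ?_
  have hcard : 
      (((Finset.Ico (0 : ℤ) N).filter (fun j : ℤ => |y + j| ≤ ρ)).card : ℝ) ≤ 2 * ρ + 1 := by
    have hss : (Finset.Ico (0 : ℤ) N).filter (fun j : ℤ => |y + j| ≤ ρ) ⊆
        Finset.Icc ⌈-ρ - y⌉ ⌊ρ - y⌋ := by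
      intro j hj
      have := abs_le.1 (Finset.mem_filter.1 hj).2
      exact Finset.mem_Icc.2 ⟨Int.ceil_le.2 (by linarith), Int.le_floor.2 (by linarith)⟩
    refine (Nat.cast_le.2 (Finset.card_le_card hss)).trans ?_
    rw [Int.card_Icc, ← Int.cast_natCast, Int.toNat_eq_max]
    push_cast
    refine max_le ?_ (by linarith)
    linarith [Int.floor_le (ρ - y), Int.le_ceil (-ρ - y)]
  refine (Finset.sum_le_card_nsmul _ _ C fun j _ => ?_).trans ?_
  · rw [norm_mul, norm_zpow, hω, one_zpow, one_mul]
    exact hC _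
  · rw [nsmul_eq_mul]
    exact mul_le_mul_of_nonneg_right hcard hC0

/-- The partial sums are as small as the full Zak transform, except near the two ends of the range
of summation, where they are bounded independently of `N`. The bound is in terms of a point `u`
near `y`. -/
theorem norm_zakSection_sq_le (hω : ‖ω‖ = 1) (hρ : ∀ z, ρ < |z| → h z = 0) (hρ0 : 0 ≤ ρ) {C : ℝ}
    (hC : ∀ z, ‖h z‖ ≤ C) (N : ℕ) {η u y : ℝ} (huy : |y - u| ≤ 1) (hη : ‖zak h ω y‖ ≤ η) :
    ‖zakSection h ω N y‖ ^ 2 ≤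
      η ^ 2 * (Set.Icc (-N - ρ - 1) (ρ + 1)).indicator 1 u +
      ((2 * ρ + 1) * C) ^ 2 * ((Set.Icc (-ρ - 1) (ρ + 1)).indicator 1 u +
        (Set.Icc (-N - ρ - 1) (-N + ρ + 1)).indicator 1 u) := by
  have hi : ∀ s : Set ℝ, 0 ≤ s.indicator (1 : ℝ → ℝ) u := fun s =>
    Set.indicator_nonneg (fun _ _ => zero_le_one) u
  obtain ⟨h1, h2⟩ := abs_le.1 huy
  have hB : ‖zakSection h ω N y‖ ^ 2 ≤ ((2 * ρ + 1) * C) ^ 2 :=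
    pow_le_pow_left₀ (norm_nonneg _) (norm_zakSection_le hω hρ hρ0 hC N y) 2
  have hp1 := mul_nonneg (sq_nonneg η) (hi (Set.Icc (-N - ρ - 1) (ρ + 1)))
  by_cases hz : ρ < y ∨ y < -N - ρ
  · rw [zakSection_eq_zero hρ hz, norm_zero, zero_pow two_ne_zero]
    exact add_nonneg hp1 (mul_nonneg (sq_nonneg _) (add_nonneg (hi _) (hi _)))
  obtain ⟨hz1, hz2⟩ := not_or.1 hz
  rw [not_lt] at hz1 hz2
  by_cases hr : -ρ < y
  · rw [Set.indicator_of_mem (s := Set.Icc (-ρ - 1) (ρ + 1)) ⟨by linarith, by linarith⟩,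
      Pi.one_apply]
    nlinarith [mul_nonneg (sq_nonneg ((2 * ρ + 1) * C)) (hi (Set.Icc (-N - ρ - 1) (-N + ρ + 1)))]
  by_cases hl : y ≤ ρ - N
  · rw [Set.indicator_of_mem (s := Set.Icc (-N - ρ - 1) (-N + ρ + 1))
      ⟨by linarith, by linarith⟩, Pi.one_apply]
    nlinarith [mul_nonneg (sq_nonneg ((2 * ρ + 1) * C)) (hi (Set.Icc (-ρ - 1) (ρ + 1)))]
  rw [zakSection_eq_zak hρ (not_lt.1 hr) (not_le.1 hl),
    Set.indicator_of_mem (s := Set.Icc (-N - ρ - 1) (ρ + 1)) ⟨by linarith, by linarith⟩,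
    Pi.one_apply, mul_one]
  exact le_add_of_le_of_nonneg (pow_le_pow_left₀ (norm_nonneg _) hη 2)
    (mul_nonneg (sq_nonneg _) (add_nonneg (hi _) (hi _)))

/-- An interval `[c, d]` contains at most `(d - c) / θ + 1` points of an arithmetic progression
with step `θ`. -/
theorem summable_indicator_progression {θ : ℝ} (hθ : 0 < θ) {c d : ℝ} (hcd : c ≤ d) (u : ℝ) :
    Summable (fun k : ℤ => (Set.Icc c d).indicator (1 : ℝ → ℝ) (u - θ * k)) ∧
    ∑' k : ℤ, (Set.Icc c d).indicator (1 : ℝ → ℝ) (u - θ * k) ≤ (d - c) / θ + 1 := by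
  have hout : ∀ k ∉ Finset.Icc ⌈(u - d) / θ⌉ ⌊(u - c) / θ⌋,
      (Set.Icc c d).indicator (1 : ℝ → ℝ) (u - θ * k) = 0 := by
    intro k hk
    refine Set.indicator_of_notMem (fun hm => hk ?_) _
    refine Finset.mem_Icc.2 ⟨Int.ceil_le.2 ?_, Int.le_floor.2 ?_⟩
    · rw [div_le_iff₀ hθ]
      linarith [hm.2]
    · rw [le_div_iff₀ hθ]
      linarith [hm.1]
  refine ⟨summable_of_ne_finset_zero hout, ?_⟩
  rw [tsum_eq_sum hout]
  refine (Finset.sum_le_card_nsmul _ _ 1 fun k _ =>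
    Set.indicator_le_self' (fun _ _ => zero_le_one) _).trans ?_
  rw [nsmul_one, Int.card_Icc, ← Int.cast_natCast, Int.toNat_eq_max]
  push_cast
  refine max_le ?_ (by have := div_nonneg (sub_nonneg.2 hcd) hθ.le; linarith)
  have : (d - c) / θ = (u - c) / θ - (u - d) / θ := by ring
  linarith [Int.floor_le ((u - c) / θ), Int.le_ceil ((u - d) / θ)]

end Section

/-! ### Gabor coefficients of step functions -/

section Gabor

/-- Parseval's identity for a function that lives on a part `(0, ε]` of a period `(0, 1 / b]`. -/
theorem hasSum_sq_norm_integral_exp {b ε : ℝ} (hb : 0 < b) (hε : 0 ≤ ε) (hεb : ε ≤ 1 / b)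
    {f : ℝ → ℂ} (hf : MemLp f 2 volume) :
    HasSum (fun m : ℤ =>
      ‖∫ t in (0 : ℝ)..ε, Complex.exp (2 * Real.pi * Complex.I * b * m * t) * f t‖ ^ 2)
      (b⁻¹ * ∫ t in (0 : ℝ)..ε, ‖f t‖ ^ 2) := by
  have hb' : (0 : ℝ) < 1 / b := by positivity
  have hsub : Set.Ioc 0 ε ⊆ Set.Ioc 0 (1 / b) := Set.Ioc_subset_Ioc_right hεb
  have hF : MemLp ((Set.Ioc 0 ε).indicator f) 2 (volume.restrict (Set.Ioc 0 (1 / b))) :=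
    (hf.indicator measurableSet_Ioc).restrict _
  have hP := hasSum_sq_fourierCoeffOn hb' hF
  have hr : ∀ φ : ℝ → ℂ → ℂ, (∀ t, φ t 0 = 0) →
      ∫ t in (0 : ℝ)..(1 / b), φ t ((Set.Ioc 0 ε).indicator f t) =
      ∫ t in (0 : ℝ)..ε, φ t (f t) := by
    intro φ hφ
    have he := setIntegral_indicator (μ := volume) (s := Set.Ioc 0 (1 / b)) (t := Set.Ioc 0 ε)
      (f := fun t => φ t (f t)) measurableSet_Ioc
    rw [Set.inter_eq_self_of_subset_right hsub] at he
    rw [intervalIntegral.integral_of_le hb'.le, intervalIntegral.integral_of_le hε,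
      ← he]
    refine setIntegral_congr_fun measurableSet_Ioc fun t _ => ?_
    by_cases ht : t ∈ Set.Ioc 0 ε <;> simp [ht, hφ]
  have e1 : ∫ t in (0 : ℝ)..(1 / b), ‖(Set.Ioc 0 ε).indicator f t‖ ^ 2 =
      ∫ t in (0 : ℝ)..ε, ‖f t‖ ^ 2 := by
    have := hr (fun _ z => ((‖z‖ ^ 2 : ℝ) : ℂ)) (by simp)
    rw [intervalIntegral.integral_ofReal, intervalIntegral.integral_ofReal] at this
    exact_mod_cast this
  rw [e1] at hP
  have e2 : ∀ m : ℤ, ‖fourierCoeffOn hb' ((Set.Ioc 0 ε).indicator f) (-m)‖ ^ 2 =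
      b ^ 2 * ‖∫ t in (0 : ℝ)..ε,
        Complex.exp (2 * Real.pi * Complex.I * b * m * t) * f t‖ ^ 2 := by
    intro m
    rw [fourierCoeffOn_eq_integral, ← hr (fun t z => Complex.exp _ * z) (by simp), norm_smul,
      mul_pow]
    congr 1
    · simp
    · congr 2
      refine intervalIntegral.integral_congr fun t _ => ?_
      simp only [smul_eq_mul, fourier_coe_apply, neg_neg]
      congr 2
      push_cast
      field_simp
      rw [sub_zero, div_div_eq_mul_div, div_one]
  have hP' := (((Equiv.neg ℤ).hasSum_iff).2 hP).mul_left (b ^ 2)⁻¹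
  have e3 : (b ^ 2)⁻¹ * ((1 / b - 0)⁻¹ • ∫ t in (0 : ℝ)..ε, ‖f t‖ ^ 2) =
      b⁻¹ * ∫ t in (0 : ℝ)..ε, ‖f t‖ ^ 2 := by
    rw [sub_zero, smul_eq_mul]
    field_simp
  rw [e3] at hP'
  refine Eq.subst (motive := fun φ : ℤ → ℝ => HasSum φ _) (funext fun m => ?_) hP'
  rw [Function.comp_apply, Equiv.neg_apply, e2, inv_mul_cancel_left₀ (by positivity)]

/-- The step function with the values `conj (ω ^ j)` on `(x₀ + j / b, x₀ + j / b + ε]` for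
`0 ≤ j < N`. -/
noncomputable def stepLp (ω : ℂ) (b x₀ ε : ℝ) (N : ℕ) : Lp ℂ 2 (volume : Measure ℝ) :=
  ∑ j ∈ Finset.Ico (0 : ℤ) N, indicatorConstLp 2
    (measurableSet_Ioc (a := x₀ + j / b) (b := x₀ + j / b + ε)) measure_Ioc_lt_top.ne
    (starRingEnd ℂ (ω ^ j))

theorem norm_stepLp_sq {ω : ℂ} (hω : ‖ω‖ = 1) {b x₀ ε : ℝ} (hb : 0 < b) (hε : 0 ≤ ε)
    (hεb : ε ≤ 1 / b) (N : ℕ) : ‖stepLp ω b x₀ ε N‖ ^ 2 = N * ε := by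
  have hin : inner ℂ (stepLp ω b x₀ ε N) (stepLp ω b x₀ ε N) = ((N * ε : ℝ) : ℂ) := by
    rw [stepLp, sum_inner]
    simp_rw [inner_sum, L2.inner_indicatorConstLp_indicatorConstLp]
    have hdiag : ∀ i ∈ Finset.Ico (0 : ℤ) N, ∑ j ∈ Finset.Ico (0 : ℤ) N,
        volume.real (Set.Ioc (x₀ + i / b) (x₀ + i / b + ε) ∩
          Set.Ioc (x₀ + j / b) (x₀ + j / b + ε)) •
          inner ℂ (starRingEnd ℂ (ω ^ i)) (starRingEnd ℂ (ω ^ j)) = (ε : ℂ) := by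
      intro i hi
      rw [Finset.sum_eq_single_of_mem i hi]
      · rw [Set.inter_self, Real.volume_real_Ioc_of_le (by linarith), inner_self_eq_norm_sq_to_K]
        simp [hω]
      · intro j _ hji
        have : Set.Ioc (x₀ + i / b) (x₀ + i / b + ε) ∩
            Set.Ioc (x₀ + j / b) (x₀ + j / b + ε) = ∅ := by
          rw [← Set.disjoint_iff_inter_eq_empty, Set.disjoint_left]
          intro x hx hx'
          have step : ∀ k l : ℤ, k < l → (k : ℝ) / b + ε ≤ l / b := by
            intro k l hkl
            have : (k : ℝ) + 1 ≤ l := by exact_mod_cast hkl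
            calc (k : ℝ) / b + ε ≤ k / b + 1 / b := by linarith
              _ = (k + 1) / b := by ring
              _ ≤ l / b := by gcongr
          rcases lt_or_gt_of_ne hji with hlt | hlt
          · linarith [step _ _ hlt, hx.1, hx'.2]
          · linarith [step _ _ hlt, hx.2, hx'.1]
        rw [this, measureReal_empty, zero_smul]
    rw [Finset.sum_congr rfl hdiag]
    simp
  rw [norm_sq_eq_re_inner (𝕜 := ℂ), hin]
  exact Complex.ofReal_re _

/-- The inner products of the step function with the Gabor system are Fourier coefficients of
partial sums of the Zak transform: the modulation frequencies `b m` do not see the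
translations by `j / b`. -/
theorem norm_inner_gaborSystem_stepLp {g : ℝ → ℂ} (hg : MemLp g 2 (volume : Measure ℝ))
    {b : ℝ} (hb : 0 < b) (ω : ℂ) (a x₀ : ℝ) {ε : ℝ} (hε : 0 ≤ ε) (N : ℕ) (k m : ℤ) :
    ‖inner ℂ (gaborSystem g hg a b (k, m)) (stepLp ω b x₀ ε N)‖ =
      ‖∫ t in (0 : ℝ)..ε, Complex.exp (2 * Real.pi * Complex.I * b * m * t) *
        zakSection (fun z => g (z / b)) ω N (b * x₀ - a * b * k + b * t)‖ := by
  have hbC : (b : ℂ) ≠ 0 := by exact_mod_cast hb.ne'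
  have hint : ∀ j : ℤ, ∫ x in Set.Ioc (x₀ + j / b) (x₀ + j / b + ε),
      gaborSystem g hg a b (k, m) x =
      Complex.exp (2 * Real.pi * Complex.I * b * m * x₀) *
      ∫ t in (0 : ℝ)..ε, Complex.exp (2 * Real.pi * Complex.I * b * m * t) *
        g (t + (x₀ + j / b - a * k)) := by
    intro j
    have e : ∫ x in Set.Ioc (x₀ + j / b) (x₀ + j / b + ε), gaborSystem g hg a b (k, m) x =
        ∫ x in Set.Ioc (x₀ + j / b) (x₀ + j / b + ε), timeFrequencyShift g a b k m x :=
      integral_congr_ae (ae_restrict_of_ae (MemLp.coeFn_toLp _))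
    rw [e, ← intervalIntegral.integral_of_le (by linarith),
      ← intervalIntegral.integral_const_mul]
    have := intervalIntegral.integral_comp_add_right (a := 0) (b := ε)
      (timeFrequencyShift g a b k m) (x₀ + j / b)
    rw [zero_add, add_comm ε] at this
    rw [← this]
    refine intervalIntegral.integral_congr fun t _ => ?_
    simp only [timeFrequencyShift]
    rw [← mul_assoc, ← Complex.exp_add, add_sub_assoc]
    congr 1
    have : (2 * Real.pi * Complex.I * b * m * ((t + (x₀ + j / b) : ℝ) : ℂ) : ℂ) =
        2 * Real.pi * Complex.I * b * m * x₀ + 2 * Real.pi * Complex.I * b * m * t +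
        ((m * j : ℤ) : ℂ) * (2 * Real.pi * Complex.I) := by
      push_cast
      field_simp
      ring
    rw [this, Complex.exp_add, Complex.exp_int_mul_two_pi_mul_I, mul_one]
  have hint' : ∀ j : ℤ, IntervalIntegrable (fun t : ℝ => ω ^ j *
      (Complex.exp (2 * Real.pi * Complex.I * b * m * t) * g (t + (x₀ + j / b - a * k))))
      volume 0 ε := by
    intro j
    have h1 : MemLp (fun t => g (t + (x₀ + j / b - a * k))) 2 (volume : Measure ℝ) :=
      hg.comp_measurePreserving (measurePreserving_add_right volume _)
    have h2 : IntervalIntegrable (fun t => g (t + (x₀ + j / b - a * k))) volume 0 ε := by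
      rw [intervalIntegrable_iff_integrableOn_Ioc_of_le hε]
      exact (h1.restrict (Set.Ioc 0 ε)).integrable one_le_two
    exact (h2.continuousOn_mul (Continuous.continuousOn (by fun_prop))).const_mul _
  rw [← norm_inner_symm, stepLp, sum_inner]
  simp_rw [L2.inner_indicatorConstLp_eq_inner_setIntegral, hint, RCLike.inner_apply,
    Complex.conj_conj]
  have hsum : ∫ t in (0 : ℝ)..ε, Complex.exp (2 * Real.pi * Complex.I * b * m * t) *
      zakSection (fun z => g (z / b)) ω N (b * x₀ - a * b * k + b * t) =
      ∑ j ∈ Finset.Ico (0 : ℤ) N, ω ^ j * ∫ t in (0 : ℝ)..ε,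
        Complex.exp (2 * Real.pi * Complex.I * b * m * t) * g (t + (x₀ + j / b - a * k)) := by
    simp_rw [← intervalIntegral.integral_const_mul]
    rw [← intervalIntegral.integral_finsetSum fun j _ => hint' j]
    refine intervalIntegral.integral_congr fun t _ => ?_
    simp only [zakSection]
    rw [Finset.mul_sum]
    refine Finset.sum_congr rfl fun j _ => ?_
    rw [mul_left_comm]
    congr 3
    field_simp
    ring
  rw [hsum]
  have : ∀ j : ℤ, (Complex.exp (2 * Real.pi * Complex.I * b * m * x₀) *
      ∫ t in (0 : ℝ)..ε, Complex.exp (2 * Real.pi * Complex.I * b * m * t) *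
        g (t + (x₀ + j / b - a * k))) * ω ^ j =
      Complex.exp (2 * Real.pi * Complex.I * b * m * x₀) * (ω ^ j *
      ∫ t in (0 : ℝ)..ε, Complex.exp (2 * Real.pi * Complex.I * b * m * t) *
        g (t + (x₀ + j / b - a * k))) := fun j => by ring
  simp_rw [this]
  rw [← Finset.mul_sum, norm_mul]
  have hone : ‖Complex.exp (2 * Real.pi * Complex.I * b * m * x₀)‖ = 1 := by
    have : (2 * Real.pi * Complex.I * b * m * x₀ : ℂ)
        = ((2 * Real.pi * b * m * x₀ : ℝ) : ℂ) * Complex.I := by push_cast; ring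
    rw [this, Complex.norm_exp_ofReal_mul_I]
  rw [hone, one_mul]

end Gabor

/-! ### Zeros of the Zak transform obstruct the frame property -/

section Obstruction

theorem memLp_zakSection {g : ℝ → ℂ} (hg : MemLp g 2 (volume : Measure ℝ)) {b : ℝ} (hb : b ≠ 0)
    (ω : ℂ) (N : ℕ) (y : ℝ) :
    MemLp (fun t => zakSection (fun z => g (z / b)) ω N (y + b * t)) 2 (volume : Measure ℝ) := by
  have h1 : MemLp (fun t => ∑ j ∈ Finset.Ico (0 : ℤ) N, ω ^ j * g (t + (y + j) / b)) 2
      (volume : Measure ℝ) :=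
    memLp_finsetSum _ fun j _ =>
      (hg.comp_measurePreserving (measurePreserving_add_right volume ((y + j) / b))).const_mul _
  convert h1 using 2 with t
  refine Finset.sum_congr rfl fun j _ => ?_
  change ω ^ j * g ((y + b * t + j) / b) = _
  congr 2
  field_simp
  ring

/-- If, for some `ω` on the unit circle, the Zak transform of the dilated window vanishes on a
coset of `q⁻¹ ℤ` at points of continuity, then the Gabor system with `a b = p / q` is no frame. -/
theorem not_isFrame_gaborSystem {g : ℝ → ℂ} (hg : MemLp g 2 (volume : Measure ℝ)) {a b ρ C : ℝ}
    (hb : 0 < b) (hρ0 : 0 ≤ ρ) (hρ : ∀ z, ρ < |z| → g (z / b) = 0) (hC : ∀ z, ‖g z‖ ≤ C)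
    {p q : ℕ} (hp : p ≠ 0) (hq : q ≠ 0) (hab : a * b = (p : ℝ) / q) {ω : ℂ} (hω : ‖ω‖ = 1) {y₀ : ℝ}
    (hc : ∀ i : ℤ, ContinuousAt (fun z => g (z / b)) (y₀ + i / q))
    (hz : ∀ i : ℤ, zak (fun z => g (z / b)) ω (y₀ + i / q) = 0) :
    ¬ IsFrame (gaborSystem g hg a b) := by
  rintro ⟨A, B, hA, -, hF⟩
  set θ := a * b
  have hθ : 0 < θ := by
    rw [hab]
    positivity
  -- `η ^ 2` is half of what the lower frame bound allows per unit of `N`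
  obtain ⟨η, hη, hη2⟩ : ∃ η : ℝ, 0 < η ∧ η ^ 2 = A * b * θ / 2 :=
    ⟨√(A * b * θ / 2), by positivity, Real.sq_sqrt (by positivity)⟩
  obtain ⟨δ, hδ, hsmall⟩ := exists_norm_zak_lt hω hρ hq hc hz hη
  -- the supports of the pieces of the step function are disjoint, and `b ε < δ`
  set ε := min (1 / b) (δ / (2 * b))
  have hε : 0 < ε := by positivity
  have hε1 : ε ≤ 1 / b := min_le_left _ _
  have hbε1 : b * ε ≤ 1 := by
    rw [le_div_iff₀ hb] at hε1
    linarith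
  have hbε2 : b * ε < δ := by
    have : ε ≤ δ / (2 * b) := min_le_right _ _
    rw [le_div_iff₀ (by positivity)] at this
    linarith
  set K := ((2 * ρ + 1) * C) ^ 2
  set x₀ := y₀ / b
  have hbx : b * x₀ = y₀ := mul_div_cancel₀ _ hb.ne'
  have hmain : ∀ N : ℕ, A * (N * ε) ≤ ε / b * (η ^ 2 * ((N + (2 * ρ + 2)) / θ + 1) +
      K * (((2 * ρ + 2) / θ + 1) + ((2 * ρ + 2) / θ + 1))) := by
    intro N
    obtain ⟨hs, hlow, -⟩ := hF (stepLp ω b x₀ ε N)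
    rw [norm_stepLp_sq hω hb hε.le hε1] at hlow
    refine hlow.trans ?_
    rw [hs.tsum_prod]
    -- the inner sums are evaluated by Parseval's identity
    have hpars : ∀ k : ℤ, HasSum (fun m : ℤ =>
        ‖inner ℂ (gaborSystem g hg a b (k, m)) (stepLp ω b x₀ ε N)‖ ^ 2)
        (b⁻¹ * ∫ t in (0 : ℝ)..ε,
          ‖zakSection (fun z => g (z / b)) ω N (y₀ - θ * k + b * t)‖ ^ 2) := by
      intro k
      simp_rw [norm_inner_gaborSystem_stepLp hg hb ω a x₀ hε.le N, hbx]
      exact hasSum_sq_norm_integral_exp hb hε.le hε1 (memLp_zakSection hg hb.ne' ω N _)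
    simp_rw [fun k => (hpars k).tsum_eq]
    have hsk : Summable fun k : ℤ => b⁻¹ * ∫ t in (0 : ℝ)..ε,
        ‖zakSection (fun z => g (z / b)) ω N (y₀ - θ * k + b * t)‖ ^ 2 := by
      have := hs.prod
      simp_rw [fun k => (hpars k).tsum_eq] at this
      exact this
    set β : ℝ → ℝ := fun u => η ^ 2 * (Set.Icc (-N - ρ - 1) (ρ + 1)).indicator 1 u +
      K * ((Set.Icc (-ρ - 1) (ρ + 1)).indicator 1 u +
        (Set.Icc (-N - ρ - 1) (-N + ρ + 1)).indicator 1 u) with hβ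
    have hk : ∀ k : ℤ, b⁻¹ * ∫ t in (0 : ℝ)..ε,
        ‖zakSection (fun z => g (z / b)) ω N (y₀ - θ * k + b * t)‖ ^ 2 ≤
        ε / b * β (y₀ - θ * k) := by
      intro k
      have hle : ∫ t in (0 : ℝ)..ε,
          ‖zakSection (fun z => g (z / b)) ω N (y₀ - θ * k + b * t)‖ ^ 2 ≤
          ∫ _ in (0 : ℝ)..ε, β (y₀ - θ * k) := by
        refine intervalIntegral.integral_mono_on hε.le ?_ intervalIntegrable_const fun t ht => ?_
        · rw [intervalIntegrable_iff_integrableOn_Ioc_of_le hε.le]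
          have hm := memLp_zakSection hg hb.ne' ω N (y₀ - θ * k)
          exact ((memLp_two_iff_integrable_sq_norm hm.aestronglyMeasurable).1 hm).integrableOn
        · have hbt : 0 ≤ b * t := mul_nonneg hb.le ht.1
          have hbt' : b * t ≤ b * ε := mul_le_mul_of_nonneg_left ht.2 hb.le
          refine norm_zakSection_sq_le hω hρ hρ0 (fun z => hC _) N ?_ ?_
          · rw [add_sub_cancel_left, abs_of_nonneg hbt]
            linarith
          · have := hsmall (b * t) (by rw [abs_of_nonneg hbt]; linarith) (-(p * k))
            have e : y₀ + ((-(p * k) : ℤ) : ℝ) / q + b * t = y₀ - θ * k + b * t := by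
              rw [hab]
              push_cast
              ring
            rw [e] at this
            exact this.le
      rw [intervalIntegral.integral_const, sub_zero, smul_eq_mul] at hle
      calc _ ≤ b⁻¹ * (ε * β (y₀ - θ * k)) :=
            mul_le_mul_of_nonneg_left hle (inv_nonneg.2 hb.le)
        _ = _ := by ring
    obtain ⟨s1, t1⟩ := summable_indicator_progression hθ
      (show (-N - ρ - 1 : ℝ) ≤ ρ + 1 by linarith [Nat.cast_nonneg (α := ℝ) N]) y₀
    obtain ⟨s2, t2⟩ := summable_indicator_progression hθ
      (show (-ρ - 1 : ℝ) ≤ ρ + 1 by linarith) y₀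
    obtain ⟨s3, t3⟩ := summable_indicator_progression hθ
      (show (-N - ρ - 1 : ℝ) ≤ -N + ρ + 1 by linarith) y₀
    have hβs : HasSum (fun k : ℤ => ε / b * β (y₀ - θ * k)) _ :=
      ((s1.hasSum.mul_left (η ^ 2)).add ((s2.hasSum.add s3.hasSum).mul_left K)).mul_left (ε / b)
    refine (hsk.tsum_le_tsum hk hβs.summable).trans ?_
    rw [hβs.tsum_eq]
    rw [show ρ + 1 - (-N - ρ - 1) = N + (2 * ρ + 2) by ring] at t1
    rw [show ρ + 1 - (-ρ - 1) = 2 * ρ + 2 by ring] at t2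
    rw [show -N + ρ + 1 - (-N - ρ - 1) = 2 * ρ + 2 by ring] at t3
    have hK0 : 0 ≤ K := sq_nonneg _
    gcongr
  -- after division by `ε`, the right-hand side grows at half the rate of the left-hand side
  set D := η ^ 2 * ((2 * ρ + 2) / θ + 1) +
    K * (((2 * ρ + 2) / θ + 1) + ((2 * ρ + 2) / θ + 1)) with hD
  obtain ⟨N, hN⟩ := exists_nat_gt (2 * D / (A * b))
  have h1 := hmain N
  have e1 : ε / b * (η ^ 2 * ((N + (2 * ρ + 2)) / θ + 1) +
      K * (((2 * ρ + 2) / θ + 1) + ((2 * ρ + 2) / θ + 1))) = ε / b * (η ^ 2 / θ * N + D) := by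
    rw [hD]
    ring
  have e2 : η ^ 2 / θ = A * b / 2 := by
    rw [hη2]
    field_simp
  rw [e1, e2, div_mul_eq_mul_div, le_div_iff₀ hb] at h1
  have h2 : A * b * N ≤ A * b / 2 * N + D := by
    refine le_of_mul_le_mul_left ?_ hε
    linarith
  rw [div_lt_iff₀ (by positivity)] at hN
  linarith

/-- The points of the coset are chosen half a step away from the centre `n m / 2` of the set
where the Zak transform need not vanish. -/
theorem not_isFrame_bsplineGabor (n : ℕ) {a b : ℝ} {m p q : ℕ} (hb : 0 < b) (hm : 2 ≤ m)
    (hp : p ≠ 0) (hq : q ≠ 0) (hab : a * b = (p : ℝ) / q)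
    (hbm : |b - m| ≤ 1 / ((n + 1 : ℝ) * q)) (h1 : n = 0 → |b - m| < 1 / (q : ℝ)) :
    ¬ IsFrame (bsplineGabor (n + 1) a b) := by
  have hm0 : m ≠ 0 := by omega
  have hprim := Complex.isPrimitiveRoot_exp m hm0
  set ω := Complex.exp (2 * Real.pi * Complex.I / m)
  have hωm : ω ^ m = 1 := hprim.pow_eq_one
  have hω1 : ω ≠ 1 := hprim.ne_one (by omega)
  have hq' : (0 : ℝ) < q := by positivity
  have hn' : (0 : ℝ) < n + 1 := by positivity
  obtain ⟨C, hC⟩ := (bspline_integrable_bounded (n + 1)).2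
  have hdist : ∀ i j : ℤ, 1 / (2 * (q : ℝ)) ≤
      |(n + 1) * (m : ℝ) / 2 + 1 / (2 * q) + i / q - (n + 1) * m / 2 - j| := by
    intro i j
    have e : (n + 1) * (m : ℝ) / 2 + 1 / (2 * q) + i / q - (n + 1) * m / 2 - j =
        ((1 + 2 * (i - q * j) : ℤ) : ℝ) / (2 * q) := by
      push_cast
      field_simp
      ring
    rw [e, abs_div, abs_of_pos (by positivity : (0 : ℝ) < 2 * q)]
    gcongr
    have : (1 : ℤ) ≤ |1 + 2 * (i - q * j)| := Int.one_le_abs (by omega)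
    exact_mod_cast this
  have hhalf : (n + 1) * |b - m| / 2 ≤ 1 / (2 * (q : ℝ)) := by
    rw [le_div_iff₀ (by positivity)] at hbm ⊢
    linarith
  refine not_isFrame_gaborSystem (bspline_memLp (n + 1)) (ρ := ((n + 1 : ℕ) : ℝ) * b / 2) (C := C)
    (y₀ := (n + 1) * (m : ℝ) / 2 + 1 / (2 * q)) hb (by positivity)
    (dilatedSpline_eq_zero (n + 1) hb) (fun z => ?_) hp hq hab
    (Complex.norm_eq_one_of_pow_eq_one hωm hm0) (fun i => ?_) fun i => ?_
  · rw [Complex.norm_real]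
    exact hC z
  · refine Complex.continuous_ofReal.continuousAt.comp ?_
    refine ContinuousAt.comp (g := bspline (n + 1)) (f := fun z => z / b) ?_ (by fun_prop)
    cases n with
    | succ n => exact (continuous_bspline n).continuousAt
    | zero =>
      have h1 := h1 rfl
      refine continuousAt_bspline_one ?_
      rw [abs_div, abs_of_pos hb, ne_eq, div_eq_iff hb.ne']
      intro h
      have hd0 := hdist i 0
      have hdm := hdist i (-m)
      have hlt : |b - m| / 2 < 1 / (2 * q) := by
        rw [lt_div_iff₀ hq'] at h1
        rw [lt_div_iff₀ (by positivity)]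
        linarith
      have hd := abs_le.1 (le_refl |b - m|)
      simp only [Nat.cast_zero, zero_add, one_mul, Int.cast_zero, Int.cast_neg,
        Int.cast_natCast] at hd0 hdm h
      rcases abs_choice ((m : ℝ) / 2 + 1 / (2 * q) + i / q) with hs | hs <;> rw [hs] at h <;>
        rcases le_abs'.1 hd0 with h2 | h2 <;> rcases le_abs'.1 hdm with h3 | h3 <;> linarith
  · cases n with
    | zero =>
      have h1 := h1 rfl
      refine zak_dilatedSpline_eq_zero 0 hb hωm hω1 hm0 fun j => lt_of_lt_of_le ?_ (hdist i j)
      rw [lt_div_iff₀ hq'] at h1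
      rw [lt_div_iff₀ (by positivity)]
      push_cast
      linarith
    | succ n =>
      refine zak_dilatedSpline_step n hb hωm hω1 hm0
        (fun y => zak_dilatedSpline_eq_zero n hb hωm hω1 hm0) fun j => ?_
      have := hhalf.trans (hdist i j)
      push_cast at this ⊢
      rwa [show (n : ℝ) + 1 + 1 = n + 2 by ring] at this ⊢

theorem round_eq_of_abs_sub_lt {b : ℝ} {m : ℤ} (h : |b - m| < 1 / 2) : round b = m := by
  rw [round_eq, Int.floor_eq_iff]
  obtain ⟨h1, h2⟩ := abs_lt.1 h
  constructor <;> linarith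

theorem not_isFrame_of_abs_sub_round_le (n : ℕ) (a b : ℝ) (p q : ℕ) (hn : 1 ≤ n) (hb : 3 / 2 < b)
    (hp : 1 ≤ p) (hq : 1 ≤ q) (hab : a * b = (p : ℝ) / q)
    (h : |b - round b| ≤ 1 / ((n : ℝ) * q)) (h1 : n = 1 → |b - round b| < 1 / (q : ℝ)) :
    ¬ IsFrame (bsplineGabor n a b) := by
  obtain ⟨n, rfl⟩ := Nat.exists_eq_add_of_le' hn
  have hr : 2 ≤ round b := by
    rw [round_eq, Int.le_floor]
    push_cast
    linarith
  have hm : ((round b).toNat : ℝ) = round b := by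
    exact_mod_cast Int.toNat_of_nonneg (by omega : 0 ≤ round b)
  rw [← hm] at h h1
  push_cast at h
  exact not_isFrame_bsplineGabor n (by linarith) (by omega) (by omega) (by omega) hab h
    fun h0 => h1 (by omega)

end Obstruction

/-! ### Pieces of hyperbolas -/

section Hyperbola

variable {n p q : ℕ} {m : ℤ}

theorem abs_sub_lt_half_of_mem (hn : 1 ≤ n) (hq : 2 ≤ q) {x : ℝ × ℝ}
    (hx : x ∈ hyperbolaPiece n p q m) : |x.2 - m| < 1 / 2 := by
  obtain ⟨-, -, -, h1, h2⟩ := hx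
  have hq' : (2 : ℝ) ≤ q := by exact_mod_cast hq
  rcases hn.eq_or_lt with rfl | hn
  · exact (h2 rfl).trans_le (one_div_le_one_div_of_le two_pos hq')
  · have hn' : (2 : ℝ) ≤ n := by exact_mod_cast hn
    exact h1.trans_lt (one_div_lt_one_div_of_lt two_pos (by nlinarith))

/-- The second coordinates of the points of a piece of the hyperbola. -/
def pieceInterval (n q : ℕ) (m : ℤ) : Set ℝ :=
  {b | |b - m| ≤ 1 / ((n : ℝ) * q) ∧ (n = 1 → |b - m| < 1 / (q : ℝ))}

theorem convex_pieceInterval : Convex ℝ (pieceInterval n q m) := by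
  have e : pieceInterval n q m = Metric.closedBall (m : ℝ) (1 / ((n : ℝ) * q)) ∩
      {b | n = 1 → b ∈ Metric.ball (m : ℝ) (1 / (q : ℝ))} := by
    ext b
    simp [pieceInterval, Real.dist_eq]
  rw [e]
  refine (convex_closedBall _ _).inter ?_
  by_cases h : n = 1
  · simp only [h, forall_const]
    exact convex_ball _ _
  · simpa [h] using convex_univ

theorem pos_of_mem_pieceInterval (hn : 1 ≤ n) (hq : 1 ≤ q) (hm : 2 ≤ m) {b : ℝ}
    (hb : b ∈ pieceInterval n q m) : 0 < b := by
  have hn' : (1 : ℝ) ≤ n := by exact_mod_cast hn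
  have hq' : (1 : ℝ) ≤ q := by exact_mod_cast hq
  have hm' : (2 : ℝ) ≤ m := by exact_mod_cast hm
  have h : 1 / ((n : ℝ) * q) ≤ 1 := by
    rw [div_le_one (by positivity)]
    nlinarith
  linarith [(abs_le.1 hb.1).1]

theorem hyperbolaPiece_eq_image (hn : 1 ≤ n) (hp : 1 ≤ p) (hq : 1 ≤ q) (hm : 2 ≤ m) :
    hyperbolaPiece n p q m = (fun b => ((p : ℝ) / q / b, b)) '' pieceInterval n q m := by
  have hq' : (0 : ℝ) < q := by exact_mod_cast hq
  have hp' : (0 : ℝ) < p := by exact_mod_cast hp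
  ext ⟨a, b⟩
  constructor
  · rintro ⟨-, hb, hab, h⟩
    exact ⟨b, h, Prod.ext (by rw [← hab]; exact mul_div_cancel_right₀ _ hb.ne') rfl⟩
  · rintro ⟨b, h, hx⟩
    obtain ⟨rfl, rfl⟩ := Prod.mk.inj hx
    have hb := pos_of_mem_pieceInterval hn hq hm h
    exact ⟨div_pos (div_pos hp' hq') hb, hb, div_mul_cancel₀ _ hb.ne', h⟩

theorem add_mem_pieceInterval (hn : 1 ≤ n) (hq : 1 ≤ q) {s : ℝ} (hs0 : 0 ≤ s)
    (hs : s ≤ 1 / (2 * ((n : ℝ) * q))) : m + s ∈ pieceInterval n q m := by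
  have hnq : (0 : ℝ) < (n : ℝ) * q := by positivity
  have hlt : s < 1 / ((n : ℝ) * q) :=
    hs.trans_lt (one_div_lt_one_div_of_lt hnq (by linarith))
  rw [pieceInterval, Set.mem_ofPred_eq, add_sub_cancel_left, abs_of_nonneg hs0]
  refine ⟨hlt.le, ?_⟩
  rintro rfl
  simpa using hlt

theorem isConnected_hyperbolaPiece (hn : 1 ≤ n) (hp : 1 ≤ p) (hq : 1 ≤ q) (hm : 2 ≤ m) :
    IsConnected (hyperbolaPiece n p q m) := by
  rw [hyperbolaPiece_eq_image hn hp hq hm]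
  refine IsConnected.image ⟨⟨_, add_mem_pieceInterval hn hq le_rfl (by positivity)⟩,
    convex_pieceInterval.isPreconnected⟩ _ ?_
  refine ContinuousOn.prodMk (continuousOn_const.div continuousOn_id fun b hb => ?_) continuousOn_id
  exact (pos_of_mem_pieceInterval hn hq hm hb).ne'

theorem nontrivial_hyperbolaPiece (hn : 1 ≤ n) (hp : 1 ≤ p) (hq : 1 ≤ q) (hm : 2 ≤ m) :
    (hyperbolaPiece n p q m).Nontrivial := by
  rw [hyperbolaPiece_eq_image hn hp hq hm]
  have hnq : (0 : ℝ) < 1 / (2 * ((n : ℝ) * q)) := by positivity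
  refine Set.Nontrivial.image ?_ fun b b' h => (Prod.mk.inj h).2
  refine ⟨_, add_mem_pieceInterval hn hq le_rfl hnq.le,
    _, add_mem_pieceInterval hn hq hnq.le le_rfl, fun h => ?_⟩
  linarith

theorem disjoint_hyperbolaPiece_bsplineFrameSet (hn : 1 ≤ n) (hp : 1 ≤ p) (hq : 2 ≤ q)
    (hm : 2 ≤ m) : Disjoint (hyperbolaPiece n p q m) (bsplineFrameSet n) := by
  refine Set.disjoint_left.2 fun x hx hF => ?_
  have hlt := abs_sub_lt_half_of_mem hn hq hx
  have hr := round_eq_of_abs_sub_lt hlt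
  obtain ⟨-, -, hab, h1, h2⟩ := hx
  rw [← hr] at h1 h2
  have hm' : (2 : ℝ) ≤ m := by exact_mod_cast hm
  exact not_isFrame_of_abs_sub_round_le n x.1 x.2 p q hn (by linarith [(abs_lt.1 hlt).1]) hp
    (by omega) hab h1 h2 hF.2.2

theorem disjoint_hyperbolaPiece (hn : 1 ≤ n) (hq : 2 ≤ q) {m' : ℤ} (hne : m ≠ m') :
    Disjoint (hyperbolaPiece n p q m) (hyperbolaPiece n p q m') := by
  refine Set.disjoint_left.2 fun x hx hx' => hne ?_
  rw [← round_eq_of_abs_sub_lt (abs_sub_lt_half_of_mem hn hq hx),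
    round_eq_of_abs_sub_lt (abs_sub_lt_half_of_mem hn hq hx')]

/-- The point of the hyperbola `a b = 1 / 2` with `b = 2 + 1 / (4 n)` is a counterexample to the
conjectured description of the frame set. -/
theorem bsplineFrameSet_ne (hn : 2 ≤ n) : bsplineFrameSet n ≠
    {ab : ℝ × ℝ | 0 < ab.1 ∧ 0 < ab.2 ∧ ab.1 * ab.2 < 1 ∧ ab.1 < n ∧
      ∀ k : ℕ, 2 ≤ k → ab.2 ≠ k} := by
  have hn' : (2 : ℝ) ≤ n := by exact_mod_cast hn
  set s : ℝ := 1 / (2 * (n * (2 : ℕ))) with hs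
  have hs0 : 0 < s := by positivity
  have hs1 : s < 1 := by
    rw [hs, div_lt_one (by positivity)]
    push_cast
    linarith
  have hmem : (((1 : ℕ) : ℝ) / (2 : ℕ) / (((2 : ℤ) : ℝ) + s), ((2 : ℤ) : ℝ) + s) ∈
      hyperbolaPiece n 1 2 2 := by
    rw [hyperbolaPiece_eq_image (by omega) le_rfl one_le_two le_rfl]
    exact ⟨_, add_mem_pieceInterval (by omega) one_le_two hs0.le le_rfl, rfl⟩
  intro heq
  refine Set.disjoint_left.1 (disjoint_hyperbolaPiece_bsplineFrameSet (by omega) le_rfl le_rfl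
    le_rfl) hmem ?_
  rw [heq]
  obtain ⟨h1, h2, h3, -⟩ := hmem
  refine ⟨h1, h2, by rw [h3]; norm_num, ?_, fun k hk hbk => ?_⟩
  · rw [div_lt_iff₀ h2]
    push_cast
    nlinarith
  · have hb : ((2 : ℤ) : ℝ) + s = k := hbk
    push_cast at hb
    have h3 : (k : ℝ) < 3 := by linarith
    have h4 : (2 : ℝ) < k := by linarith
    norm_cast at h3 h4
    omega

end Hyperbola

theorem theorem3p4 :
    -- the family of obstructions
    (∀ (n : ℕ) (a b : ℝ) (p q : ℕ), 1 ≤ n → 0 < a → 3 / 2 < b → 1 ≤ p → 1 ≤ q →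
      Nat.Coprime p q → a * b = (p : ℝ) / q →
      |b - round b| ≤ 1 / ((n : ℝ) * q) →
      (n = 1 → |b - round b| < 1 / (q : ℝ)) →
      ¬ IsFrame (bsplineGabor n a b)) ∧
    -- infinitely many pieces of each rational hyperbola `a b = p / q < 1` miss the frame set
    (∀ n p q : ℕ, 1 ≤ n → 1 ≤ p → p < q → Nat.Coprime p q →
      (∀ m : ℤ, 2 ≤ m →
        IsConnected (hyperbolaPiece n p q m) ∧ (hyperbolaPiece n p q m).Nontrivial ∧
        Disjoint (hyperbolaPiece n p q m) (bsplineFrameSet n)) ∧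
      (∀ m m' : ℤ, 2 ≤ m → 2 ≤ m' → m ≠ m' →
        Disjoint (hyperbolaPiece n p q m) (hyperbolaPiece n p q m'))) ∧
    -- the conjectured description of the frame set fails for every order `n ≥ 2`
    (∀ n : ℕ, 2 ≤ n →
      bsplineFrameSet n ≠
        {ab : ℝ × ℝ | 0 < ab.1 ∧ 0 < ab.2 ∧ ab.1 * ab.2 < 1 ∧ ab.1 < n ∧
          ∀ k : ℕ, 2 ≤ k → ab.2 ≠ k}) := by
  refine ⟨fun n a b p q hn _ hb hp hq _ hab h h1 =>
    not_isFrame_of_abs_sub_round_le n a b p q hn hb hp hq hab h h1,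
    fun n p q hn hp hpq _ => ⟨fun m hm => ⟨isConnected_hyperbolaPiece hn hp (by omega) hm,
      nontrivial_hyperbolaPiece hn hp (by omega) hm,
      disjoint_hyperbolaPiece_bsplineFrameSet hn hp (by omega) hm⟩,
      fun m m' _ _ hne => disjoint_hyperbolaPiece hn (by omega) hne⟩,
    fun n hn => bsplineFrameSet_ne hn⟩
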